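/- Let $G$ be a locally compact (Hausdorff) group with a left Haar measure $\mu$, let $1\le p<\infty$, let $S\subset G$, and let $\omega:G\to(0,\infty)$ be a measurable, locally $p$-integrable function which is $S$-admissible, i.e. $\operatorname{ess\,sup}_{t\in G}\,\omega(st)/\omega(t)<\infty$ for every $s\in S$. Let $L^p(G,\omega)$ be the space of (classes of) measurable functions $f:G\to\mathbb C$ with $\|f\|_{p,\omega}:=\big(\int_G|f(t)|^p\omega(t)^p\,d\mu(t)\big)^{1/p}<\infty$, and for $s\in S$ let $T_s$ be the left translation operator on $L^p(G,\omega)$, $(T_sf)(t)=f(s^{-1}t)$. A vector $f\in L^p(G,\omega)$ is called $S$-dense if $\{T_sf:\ s\in S\}$ is dense in $L^p(G,\omega)$, and, for $\Gamma\subset\mathbb C$, it is called $(\Gamma,S)$-dense if $\{\gamma T_sf:\ \gamma\in\Gamma,\ s\in S\}$ is dense in $L^p(G,\omega)$. Let $\Gamma\subset\mathbb C$ be such that $\Gamma\setminus\{0\}$ is non-empty, bounded and bounded away from zero (there is $c>0$ with $|z|\ge c$ for all $z\in\Gamma\setminus\{0\}$). Then $L^p(G,\omega)$ has an $S$-dense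 vector if and only if it has a $(\Gamma,S)$-dense vector. -/

import Mathlib

open MeasureTheory
open scoped ENNReal

namespace WeightedLp

variable {G : Type*} [Group G] [TopologicalSpace G] [IsTopologicalGroup G]
  [MeasurableSpace G] [BorelSpace G]

/-- A weight on `G`: a positive, measurable, locally `p`-integrable function. -/
structure IsWeight (μ : Measure G) (p : ℝ≥0∞) (ω : G → ℝ) : Prop where
  aemeasurable : AEMeasurable ω μ
  pos : ∀ t, 0 < ω t
  locallyIntegrable : LocallyIntegrable (fun t => ω t ^ p.toReal) μ

/-- `M(s) = ess sup_t ω(st) / ω(t)`, as an element of `[0, ∞]`. -/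
noncomputable def translationBound (μ : Measure G) (ω : G → ℝ) (s : G) : ℝ≥0∞ :=
  essSup (fun t => ENNReal.ofReal (ω (s * t) / ω t)) μ

/-- `ω` is an `S`-admissible weight: it is a weight and `M(s) < ∞` for all `s ∈ S`. -/
structure IsAdmissible (μ : Measure G) (p : ℝ≥0∞) (ω : G → ℝ) (S : Set G) : Prop
    extends IsWeight μ p ω where
  bound_lt_top : ∀ s ∈ S, translationBound μ ω s < ∞

/-- The measure `ω(t) ^ p dμ(t)`. -/
noncomputable def weightedMeasure (μ : Measure G) (p : ℝ≥0∞) (ω : G → ℝ) : Measure G :=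
  μ.withDensity (fun t => ENNReal.ofReal (ω t) ^ p.toReal)

/-- The weighted space `L^p(G, ω)` (for `1 ≤ p < ∞`): classes of measurable `f : G → ℂ` with
`∫ |f(t)| ^ p ω(t) ^ p dμ(t) < ∞`, with the norm `(∫ |f(t)| ^ p ω(t) ^ p dμ(t)) ^ (1 / p)`. -/
noncomputable abbrev Space (μ : Measure G) (p : ℝ≥0∞) (ω : G → ℝ) :
    AddSubgroup (G →ₘ[weightedMeasure μ p ω] ℂ) :=
  Lp ℂ p (weightedMeasure μ p ω)

/-- The image of `ω ^ p dμ` under `t ↦ s⁻¹ t` is at most `M(s) ^ p` times `ω ^ p dμ`. -/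
theorem map_weightedMeasure_le {μ : Measure G} [μ.IsHaarMeasure] {p : ℝ≥0∞} {ω : G → ℝ}
    {S : Set G} (h : IsAdmissible μ p ω S) (s : G) :
    (weightedMeasure μ p ω).map (fun t => s⁻¹ * t) ≤
      (translationBound μ ω s ^ p.toReal) • weightedMeasure μ p ω := by
  have hm : Measurable (fun t : G => s⁻¹ * t) := measurable_const_mul s⁻¹
  have hω : AEMeasurable (fun t => ENNReal.ofReal (ω t) ^ p.toReal) μ :=
    h.aemeasurable.ennreal_ofReal.pow_const _
  refine Measure.le_iff.2 fun A hA => ?_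
  have hsA : MeasurableSet ((fun t : G => s⁻¹ * t) ⁻¹' A) := hm hA
  rw [Measure.map_apply hm hA, Measure.smul_apply, weightedMeasure, withDensity_apply _ hsA,
    withDensity_apply _ hA, smul_eq_mul, ← lintegral_const_mul'' _ hω.restrict,
    ← lintegral_indicator hsA, ← lintegral_indicator hA,
    ← lintegral_mul_left_eq_self _ s]
  refine lintegral_mono_ae ?_
  filter_upwards [ENNReal.ae_le_essSup (μ := μ)
    (fun t => ENNReal.ofReal (ω (s * t) / ω t))] with t ht
  by_cases htA : t ∈ A
  · have h1 : s * t ∈ (fun t : G => s⁻¹ * t) ⁻¹' A := by simpa using htA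
    rw [Set.indicator_of_mem h1, Set.indicator_of_mem htA,
      ← ENNReal.mul_rpow_of_nonneg _ _ ENNReal.toReal_nonneg]
    refine ENNReal.rpow_le_rpow ?_ ENNReal.toReal_nonneg
    calc ENNReal.ofReal (ω (s * t))
        = ENNReal.ofReal (ω (s * t) / ω t) * ENNReal.ofReal (ω t) := by
          rw [← ENNReal.ofReal_mul (div_pos (h.pos _) (h.pos _)).le,
            div_mul_cancel₀ _ (h.pos t).ne']
      _ ≤ _ := by gcongr; exact ht
  · have h1 : s * t ∉ (fun t : G => s⁻¹ * t) ⁻¹' A := by simpa using htA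
    rw [Set.indicator_of_notMem h1]
    exact zero_le

theorem memLp_translate {μ : Measure G} [μ.IsHaarMeasure] {p : ℝ≥0∞} {ω : G → ℝ}
    {S : Set G} (h : IsAdmissible μ p ω S) {s : G} (hs : s ∈ S) (f : Space μ p ω) :
    MemLp (fun t => f (s⁻¹ * t)) p (weightedMeasure μ p ω) := by
  have hm : Measurable (fun t : G => s⁻¹ * t) := measurable_const_mul s⁻¹
  have hc : translationBound μ ω s ^ p.toReal ≠ ∞ :=
    ENNReal.rpow_ne_top_of_nonneg ENNReal.toReal_nonneg (h.bound_lt_top s hs).ne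
  have h1 : MemLp f p ((weightedMeasure μ p ω).map (fun t => s⁻¹ * t)) :=
    (Lp.memLp f).of_measure_le_smul hc (map_weightedMeasure_le h s)
  exact h1.comp_of_map hm.aemeasurable

/-- The left translation operator `(T_s f)(t) = f(s⁻¹ t)` on `L^p(G, ω)`, for `s ∈ S`,
where `ω` is `S`-admissible. -/
noncomputable def translate {μ : Measure G} [μ.IsHaarMeasure] {p : ℝ≥0∞} {ω : G → ℝ}
    {S : Set G} (h : IsAdmissible μ p ω S) (s : S) (f : Space μ p ω) : Space μ p ω :=
  (memLp_translate h s.2 f).toLp (fun t => f ((s : G)⁻¹ * t))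

/-- `f` is `S`-dense: the orbit `{T_s f : s ∈ S}` is dense in `L^p(G, ω)`. -/
def IsSDense {μ : Measure G} [μ.IsHaarMeasure] {p : ℝ≥0∞} [Fact (1 ≤ p)] {ω : G → ℝ}
    {S : Set G} (h : IsAdmissible μ p ω S) (f : Space μ p ω) : Prop :=
  Dense {g : Space μ p ω | ∃ s : S, g = translate h s f}

/-- `f` is `(Γ, S)`-dense: the set `{γ T_s f : γ ∈ Γ, s ∈ S}` is dense in `L^p(G, ω)`. -/
def IsGammaSDense {μ : Measure G} [μ.IsHaarMeasure] {p : ℝ≥0∞} [Fact (1 ≤ p)] {ω : G → ℝ}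
    (Γ : Set ℂ) {S : Set G} (h : IsAdmissible μ p ω S) (f : Space μ p ω) : Prop :=
  Dense {g : Space μ p ω | ∃ γ ∈ Γ, ∃ s : S, g = γ • translate h s f}

end WeightedLp

namespace WeightedLp

/-! ### Translations as bounded operators. -/

section Translate

variable {G : Type*} [Group G] [TopologicalSpace G] [IsTopologicalGroup G]
  [MeasurableSpace G] [BorelSpace G]
  {μ : Measure G} [μ.IsHaarMeasure] {p : ℝ≥0∞} {ω : G → ℝ} {S : Set G}

/-! Multiplying by one nonzero `γ ∈ Γ` is a homeomorphism, so an `S`-dense vector is `(Γ, S)`-dense.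
For the converse let `f` be `(Γ, S)`-dense and approximate a tall plateau `N · 1_F` by `γ T_s f`,
with `γ ≠ 0`. Since `|γ|` lies between two positive constants, `f` must be large on most of `s⁻¹F`,
and `T_s` must nearly kill the part of `f` where `|f|` is bounded by a constant small against `N`. A
bounded target `g` living on `F` can then be copied onto the set where `f` is large: this gives a
vector `u` with `T_s u ≈ g` and `|u| ≤ δ |f|`, hence small in norm (`exists_translate_sub_le`). In
`exists_isSDense_of_isGammaSDense` such vectors `u_n`, built for targets running through a countable
dense set, are summed. In `T_n (∑ u_k)` the terms `k < n` are small because `u_k` sits where `|f|`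
is bounded, and the terms `k > n` because `u_k` was chosen small against `‖T_n‖`. The countable
dense set comes from `separableSpace_of_isGammaSDense`: a dense vector forces `G` to be σ-compact,
and then its orbit is separable. -/

theorem quasiMeasurePreserving_translate (h : IsAdmissible μ p ω S) (s : S) :
    Measure.QuasiMeasurePreserving (fun t : G => (s : G)⁻¹ * t)
      (weightedMeasure μ p ω) (weightedMeasure μ p ω) :=
  ⟨measurable_const_mul _, (Measure.absolutelyContinuous_of_le (map_weightedMeasure_le h s)).trans
    (Measure.smul_absolutelyContinuous)⟩

theorem coeFn_translate (h : IsAdmissible μ p ω S) (s : S) (f : Space μ p ω) :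
    translate h s f =ᵐ[weightedMeasure μ p ω] fun t => f ((s : G)⁻¹ * t) :=
  MemLp.coeFn_toLp _

theorem coeFn_translate_of_ae_eq (h : IsAdmissible μ p ω S) (s : S) {f : Space μ p ω} {φ : G → ℂ}
    (hφ : f =ᵐ[weightedMeasure μ p ω] φ) :
    translate h s f =ᵐ[weightedMeasure μ p ω] fun t => φ ((s : G)⁻¹ * t) :=
  (coeFn_translate h s f).trans ((quasiMeasurePreserving_translate h s).ae_eq_comp hφ)

theorem norm_translate_le (hp : p ≠ ∞) (h : IsAdmissible μ p ω S) (s : S)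
    (f : Space μ p ω) :
    ‖translate h s f‖ ≤
      ((translationBound μ ω s ^ p.toReal) ^ (1 / p).toReal).toReal * ‖f‖ := by
  have hc : translationBound μ ω s ^ p.toReal ≠ ∞ :=
    ENNReal.rpow_ne_top_of_nonneg ENNReal.toReal_nonneg (h.bound_lt_top s s.2).ne
  have hm := (Lp.aestronglyMeasurable f).mono_ac (quasiMeasurePreserving_translate h s).2
  have key : eLpNorm (translate h s f) p (weightedMeasure μ p ω) ≤
      (translationBound μ ω s ^ p.toReal) ^ (1 / p).toReal *
        eLpNorm f p (weightedMeasure μ p ω) := by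
    rw [eLpNorm_congr_ae (coeFn_translate h s f)]
    change eLpNorm (f ∘ fun t => (s : G)⁻¹ * t) p _ ≤ _
    rw [← eLpNorm_map_measure hm (measurable_const_mul _).aemeasurable]
    refine (eLpNorm_mono_measure _ (map_weightedMeasure_le h s)).trans ?_
    rw [eLpNorm_smul_measure_of_ne_top hp, smul_eq_mul]
  rw [Lp.norm_def, Lp.norm_def, ← ENNReal.toReal_mul]
  exact ENNReal.toReal_mono (ENNReal.mul_ne_top
    (ENNReal.rpow_ne_top_of_nonneg ENNReal.toReal_nonneg hc) (Lp.eLpNorm_ne_top f)) key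

/-- Translation by `s ∈ S` as a bounded linear operator. -/
noncomputable def translateCLM [Fact (1 ≤ p)] (hp : p ≠ ∞) (h : IsAdmissible μ p ω S) (s : S) :
    Space μ p ω →L[ℂ] Space μ p ω :=
  LinearMap.mkContinuous
    { toFun := translate h s
      map_add' := fun f g => by
        refine Lp.ext ((coeFn_translate_of_ae_eq h s (Lp.coeFn_add f g)).trans ?_)
        refine .trans ?_ (Lp.coeFn_add _ _).symm
        filter_upwards [coeFn_translate h s f, coeFn_translate h s g] with t hf hg
        simp [hf, hg]
      map_smul' := fun c f => by
        refine Lp.ext ((coeFn_translate_of_ae_eq h s (Lp.coeFn_smul c f)).trans ?_)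
        refine .trans ?_ (Lp.coeFn_smul _ _).symm
        filter_upwards [coeFn_translate h s f] with t hf
        simp [hf] }
    _ (norm_translate_le hp h s)

theorem translateCLM_apply [Fact (1 ≤ p)] (hp : p ≠ ∞) (h : IsAdmissible μ p ω S) (s : S)
    (f : Space μ p ω) : translateCLM hp h s f = translate h s f := rfl

end Translate

/-! ### Regularity of measures with a positive density. -/

section Measure

open Set Filter Topology TopologicalSpace

variable {G : Type*} [TopologicalSpace G] [MeasurableSpace G] [BorelSpace G]
  {μ : Measure G}

/-- A set of finite measure for a positive density with respect to a regular measure is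
σ-compact up to a null set. -/
theorem exists_isSigmaCompact_subset_withDensity [T2Space G] [μ.Regular]
    {d : G → ℝ≥0∞} (hd : AEMeasurable d μ) (hd0 : ∀ x, d x ≠ 0) {A : Set G}
    (hA : MeasurableSet A) (hAfin : μ.withDensity d A ≠ ∞) :
    ∃ U ⊆ A, IsSigmaCompact U ∧ μ.withDensity d (A \ U) = 0 := by
  let e := hd.mk d
  have he : Measurable e := hd.measurable_mk
  -- Bounding the density below makes each slice `μ`-finite, so regularity of `μ` exhausts it by
  -- compact sets; positivity of `d` makes the slices cover `A` up to a null set.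
  let B : ℕ → Set G := fun n => A ∩ {x | ((n : ℝ≥0∞) + 1)⁻¹ ≤ e x}
  have hB : ∀ n, MeasurableSet (B n) := fun n => hA.inter (measurableSet_le measurable_const he)
  have hBfin : ∀ n, μ (B n) ≠ ∞ := by
    intro n hn
    refine hAfin (top_unique ?_)
    calc ∞ = ((n : ℝ≥0∞) + 1)⁻¹ * μ (B n) := by
            rw [hn, ENNReal.mul_top]; simp
      _ = ∫⁻ _ in B n, ((n : ℝ≥0∞) + 1)⁻¹ ∂μ := by simp
      _ ≤ ∫⁻ x in B n, e x ∂μ := setLIntegral_mono he fun x hx => hx.2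
      _ ≤ ∫⁻ x in A, e x ∂μ := lintegral_mono_set inter_subset_left
      _ = μ.withDensity d A := by
          rw [withDensity_congr_ae hd.ae_eq_mk, withDensity_apply _ hA]
  have hK : ∀ n j : ℕ, ∃ K ⊆ B n, IsCompact K ∧ μ (B n \ K) < ((j : ℝ≥0∞) + 1)⁻¹ :=
    fun n j => (hB n).exists_isCompact_sdiff_lt (hBfin n) (by simp)
  choose K hKB hKc hKμ using hK
  refine ⟨⋃ n, ⋃ j, K n j, iUnion₂_subset fun n j => (hKB n j).trans inter_subset_left,
    isSigmaCompact_iUnion _ fun n => isSigmaCompact_iUnion_of_isCompact _ (hKc n), ?_⟩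
  refine withDensity_absolutelyContinuous μ d ?_
  have hnull : ∀ n, μ (B n \ ⋃ n, ⋃ j, K n j) = 0 := by
    intro n
    refine le_antisymm (ge_of_tendsto' (x := (atTop : Filter ℕ)) (a := (0 : ℝ≥0∞))
      (f := fun j : ℕ => ((j : ℝ≥0∞) + 1)⁻¹) ?_ fun j => ?_) zero_le
    · have := (ENNReal.tendsto_inv_nat_nhds_zero).comp (tendsto_add_atTop_nat 1)
      simpa [Function.comp_def] using this
    · exact (measure_mono (sdiff_subset_sdiff_right
        (subset_iUnion₂_of_subset n j subset_rfl))).trans (hKμ n j).le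
  refine measure_mono_null (t := {x | d x ≠ e x} ∪ ⋃ n, (B n \ ⋃ n, ⋃ j, K n j)) ?_
    (measure_union_null hd.ae_eq_mk (measure_iUnion_null hnull))
  rintro x ⟨hxA, hxU⟩
  by_cases hx : d x = e x
  · refine Or.inr ?_
    obtain ⟨n, hn⟩ := ENNReal.exists_inv_nat_lt (hx ▸ hd0 x)
    refine mem_iUnion.2 ⟨n, ⟨hxA, le_trans ?_ hn.le⟩, hxU⟩
    exact ENNReal.inv_le_inv.2 (by simp)
  · exact Or.inl hx

theorem innerRegularCompactLTTop_withDensity [T2Space G] [μ.Regular]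
    {d : G → ℝ≥0∞} (hd : AEMeasurable d μ) (hd0 : ∀ x, d x ≠ 0) :
    (μ.withDensity d).InnerRegularCompactLTTop := by
  refine ⟨fun A hA r hr => ?_⟩
  obtain ⟨U, hUA, ⟨K, hKc, rfl⟩, hnull⟩ :=
    exists_isSigmaCompact_subset_withDensity hd hd0 hA.1 hA.2
  have hle : μ.withDensity d A ≤ μ.withDensity d (⋃ n, K n) :=
    measure_mono_ae (ae_le_set.2 hnull)
  rw [measure_iUnion_eq_iSup_accumulate] at hle
  obtain ⟨n, hn⟩ := lt_iSup_iff.1 (hr.trans_le hle)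
  refine ⟨accumulate K n, (accumulate_subset_iUnion n).trans hUA, ?_, hn⟩
  rw [accumulate_def]
  exact (finite_Iic n).isCompact_biUnion fun i _ => hKc i

theorem regular_of_innerRegularCompactLTTop [R1Space G] [SigmaCompactSpace G]
    (ν : Measure G) [IsLocallyFiniteMeasure ν] [ν.InnerRegularCompactLTTop] : ν.Regular := by
  let s := ν.finiteSpanningSetsInOpen
  -- On open pieces of finite measure, inner regularity passes to complements.
  have : ν.OuterRegular := by
    refine Measure.OuterRegular.of_restrict (s := s.set) (fun n => ?_) (fun n => (show IsOpen _ from s.set_mem n))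
      s.spanning.ge
    have : IsFiniteMeasure (ν.restrict (s.set n)) := ⟨by simpa using s.finite n⟩
    infer_instance
  have : SigmaFinite ν := s.sigmaFinite
  exact ⟨fun U hU r hr => Measure.InnerRegular.innerRegular hU.measurableSet r hr⟩

/-- A function in `L^p` for a positive density vanishes a.e. outside a σ-compact set. -/
theorem exists_isSigmaCompact_ae_eq_zero [T2Space G] [μ.Regular]
    {d : G → ℝ≥0∞} (hd : AEMeasurable d μ) (hd0 : ∀ x, d x ≠ 0) {p : ℝ≥0∞} (hp0 : p ≠ 0)
    (hp : p ≠ ∞) (f : Lp ℂ p (μ.withDensity d)) :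
    ∃ A, IsSigmaCompact A ∧ ∀ᵐ x ∂μ.withDensity d, x ∉ A → f x = 0 := by
  have hfin : ∀ n : ℕ, μ.withDensity d {x | ((n : ℝ) + 1)⁻¹ ≤ ‖f x‖} ≠ ∞ := by
    intro n
    have := (Lp.memLp f).meas_ge_lt_top hp0 hp (ε := ((n : NNReal) + 1)⁻¹) (by positivity)
    refine ne_of_lt (lt_of_le_of_lt (measure_mono fun x hx => ?_) this)
    have hx : ((n : ℝ) + 1)⁻¹ ≤ ‖f x‖ := hx
    change ((n : NNReal) + 1)⁻¹ ≤ ‖f x‖₊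
    rw [← NNReal.coe_le_coe]
    simpa using hx
  have hmeas : ∀ n : ℕ, MeasurableSet {x | ((n : ℝ) + 1)⁻¹ ≤ ‖f x‖} := fun n =>
    measurableSet_le measurable_const (Lp.stronglyMeasurable f).norm.measurable
  choose U _ hUc hU using fun n =>
    exists_isSigmaCompact_subset_withDensity hd hd0 (hmeas n) (hfin n)
  refine ⟨⋃ n, U n, isSigmaCompact_iUnion _ hUc, ?_⟩
  filter_upwards [ae_all_iff.2 fun n => measure_eq_zero_iff_ae_notMem.1 (hU n)] with x hx hxU
  by_contra hne
  obtain ⟨n, hn⟩ := exists_nat_one_div_lt (norm_pos_iff.2 hne)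
  exact hx n ⟨by simpa using hn.le, fun h => hxU (mem_iUnion.2 ⟨n, h⟩)⟩

end Measure

/-! ### Basic properties of the weighted measure. -/

section Weight

variable {G : Type*} [TopologicalSpace G] [MeasurableSpace G]
  {μ : Measure G} {p : ℝ≥0∞} {ω : G → ℝ}

theorem IsWeight.aemeasurable_density (h : IsWeight μ p ω) :
    AEMeasurable (fun t => ENNReal.ofReal (ω t) ^ p.toReal) μ :=
  h.aemeasurable.ennreal_ofReal.pow_const _

theorem IsWeight.density_ne_zero (h : IsWeight μ p ω) (t : G) :
    ENNReal.ofReal (ω t) ^ p.toReal ≠ 0 :=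
  (ENNReal.rpow_pos (ENNReal.ofReal_pos.2 (h.pos t)) ENNReal.ofReal_ne_top).ne'

theorem IsWeight.isLocallyFiniteMeasure [OpensMeasurableSpace G] (h : IsWeight μ p ω) :
    IsLocallyFiniteMeasure (weightedMeasure μ p ω) := by
  refine ⟨fun x => ?_⟩
  obtain ⟨U, hU, hint⟩ := h.locallyIntegrable x
  obtain ⟨V, hVU, hV, hxV⟩ := mem_nhds_iff.1 hU
  refine ⟨V, hV.mem_nhds hxV, ?_⟩
  rw [weightedMeasure, withDensity_apply _ hV.measurableSet]
  simp_rw [ENNReal.ofReal_rpow_of_pos (h.pos _)]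
  exact (hint.mono_set hVU).lintegral_lt_top

theorem IsWeight.isOpenPosMeasure [μ.IsOpenPosMeasure] (h : IsWeight μ p ω) :
    (weightedMeasure μ p ω).IsOpenPosMeasure :=
  (withDensity_absolutelyContinuous' h.aemeasurable_density
    (Filter.Eventually.of_forall h.density_ne_zero)).isOpenPosMeasure

end Weight

/-! ### A dense vector forces σ-compactness and separability. -/

section Separable

open Set Filter Topology TopologicalSpace Pointwise

variable {G : Type*} [Group G] [TopologicalSpace G] [IsTopologicalGroup G]
  [MeasurableSpace G] [BorelSpace G]

theorem memLp_translate_of_hasCompactSupport (ν : Measure G) [IsFiniteMeasureOnCompacts ν]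
    (p : ℝ≥0∞) {φ : G → ℂ} (hφ : Continuous φ) (hc : HasCompactSupport φ) (s : G) :
    MemLp (fun t => φ (s⁻¹ * t)) p ν :=
  (hφ.comp (continuous_const_mul _)).memLp_of_hasCompactSupport
    (hc.comp_homeomorph (Homeomorph.mulLeft s⁻¹))

/-- For `s` near `a` all translates live on one compact set `F`, where they converge uniformly;
finiteness of `ν F` turns this into `L^p` convergence. -/
theorem continuous_toLp_translate [LocallyCompactSpace G] [T2Space G] (ν : Measure G)
    [IsFiniteMeasureOnCompacts ν]
    {p : ℝ≥0∞} [Fact (1 ≤ p)] {φ : G → ℂ} (hφ : Continuous φ)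
    (hc : HasCompactSupport φ) :
    Continuous fun s : G => (memLp_translate_of_hasCompactSupport ν p hφ hc s).toLp := by
  refine continuous_iff_continuousAt.2 fun a => ?_
  obtain ⟨L, hL, haL⟩ := exists_compact_mem_nhds a
  let F := L * tsupport φ
  have hF : IsCompact F := hL.mul hc
  have hsupp : ∀ s ∈ L, ∀ t ∉ F, φ (s⁻¹ * t) = 0 := by
    intro s hs t ht
    by_contra hne
    exact ht ⟨s, hs, s⁻¹ * t, subset_tsupport _ hne, by simp⟩
  refine Metric.tendsto_nhds.2 fun ε hε => ?_
  let c : ℝ := (ν F ^ (1 / p.toReal)).toReal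
  have hνF : ν F ^ (1 / p.toReal) ≠ ∞ :=
    ENNReal.rpow_ne_top_of_nonneg (by positivity) hF.measure_lt_top.ne
  have hη : 0 < ε / (2 * (c + 1)) := by positivity
  have hunif : ∀ᶠ s in 𝓝 a, ∀ t ∈ F, ‖φ (s⁻¹ * t) - φ (a⁻¹ * t)‖ < ε / (2 * (c + 1)) := by
    refine hF.eventually_forall_of_forall_eventually fun t _ => ?_
    have hcont : Continuous fun z : G × G => ‖φ (z.1⁻¹ * z.2) - φ (a⁻¹ * z.2)‖ := by fun_prop
    exact hcont.continuousAt.eventually_lt_const (by simpa using hη)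
  filter_upwards [hunif, haL] with s hs hsL
  rw [dist_eq_norm, ← MemLp.toLp_sub, Lp.norm_toLp]
  have hind : ((fun t => φ (s⁻¹ * t)) - fun t => φ (a⁻¹ * t)) =
      F.indicator ((fun t => φ (s⁻¹ * t)) - fun t => φ (a⁻¹ * t)) := by
    refine (indicator_eq_self.2 fun t ht => ?_).symm
    by_contra htF
    exact ht (by simp [hsupp s hsL t htF, hsupp a (mem_of_mem_nhds haL) t htF])
  have hle : eLpNorm ((fun t => φ (s⁻¹ * t)) - fun t => φ (a⁻¹ * t)) p ν ≤
      ENNReal.ofReal (ε / (2 * (c + 1))) * ν F ^ (1 / p.toReal) := by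
    rw [hind, eLpNorm_indicator_eq_eLpNorm_restrict hF.measurableSet]
    refine (eLpNorm_le_of_ae_bound (C := ε / (2 * (c + 1))) ?_).trans ?_
    · filter_upwards [ae_restrict_mem hF.measurableSet] with t ht using (hs t ht).le
    · rw [Measure.restrict_apply_univ, mul_comm, one_div]
  calc _ ≤ (ENNReal.ofReal (ε / (2 * (c + 1))) * ν F ^ (1 / p.toReal)).toReal :=
        ENNReal.toReal_mono (ENNReal.mul_ne_top ENNReal.ofReal_ne_top hνF) hle
    _ = ε * (c / (2 * (c + 1))) := by
        rw [ENNReal.toReal_mul, ENNReal.toReal_ofReal hη.le]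
        ring
    _ < ε := by
        have hc0 : 0 ≤ c := ENNReal.toReal_nonneg
        refine mul_lt_of_lt_one_right hε ((div_lt_one (by positivity)).2 (by linarith))

variable [LocallyCompactSpace G] [T2Space G] {μ : Measure G} [μ.IsHaarMeasure] [μ.Regular]
  {p : ℝ≥0∞} [Fact (1 ≤ p)] {ω : G → ℝ} {S : Set G}

/-- A group whose weighted `L^p` space has a `(Γ, S)`-dense vector is σ-compact. -/
theorem sigmaCompactSpace_of_isGammaSDense (hp : p ≠ ∞) (h : IsAdmissible μ p ω S) {Γ : Set ℂ}
    {f : Space μ p ω} (hf : IsGammaSDense Γ h f) : SigmaCompactSpace G := by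
  have hp0 : p ≠ 0 := (zero_lt_one.trans_le Fact.out).ne'
  have := h.toIsWeight.isLocallyFiniteMeasure
  have := h.toIsWeight.isOpenPosMeasure
  obtain ⟨A, hA, hfA⟩ := exists_isSigmaCompact_ae_eq_zero h.toIsWeight.aemeasurable_density
    h.toIsWeight.density_ne_zero hp0 hp f
  replace hfA : ∀ᵐ x ∂weightedMeasure μ p ω, x ∉ A → f x = 0 := hfA
  obtain ⟨V, hV, hV1⟩ := exists_compact_mem_nhds (1 : G)
  -- If `γ T_s f` is closer to the indicator of `V ∪ tV` than the norms of `1_V` and `1_{tV}`, it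
  -- cannot vanish a.e. on either piece, so `sA` meets both. Eliminating `s` gives `t ∈ V A⁻¹ A
  -- V⁻¹`.
  have key : ∀ t : G, ∃ s : G, ∃ a ∈ A, ∃ b ∈ A, s * a ∈ V ∧ t⁻¹ * (s * b) ∈ V := by
    intro t
    let W := V ∪ t • V
    have hW : IsCompact W := hV.union (hV.smul t)
    let w : Space μ p ω := indicatorConstLp p hW.measurableSet hW.measure_lt_top.ne (1 : ℂ)
    have hpos : ∀ x : G, 0 < weightedMeasure μ p ω (x • V) := fun x =>
      Measure.measure_pos_of_mem_nhds _ (show x • V ∈ 𝓝 (x • (1 : G)) from smul_mem_nhds_smul x hV1)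
    have hVx : ∀ x : G, IsCompact (x • V) := fun x => hV.smul x
    let m : G → ℝ := fun x => ‖(indicatorConstLp p (hVx x).measurableSet (hVx x).measure_lt_top.ne
      (1 : ℂ) : Space μ p ω)‖
    have hm : ∀ x, 0 < m x := by
      intro x
      simp only [m]
      rw [norm_indicatorConstLp hp0 hp]
      simp only [norm_one, one_mul]
      exact Real.rpow_pos_of_pos (ENNReal.toReal_pos (hpos x).ne' (hVx x).measure_lt_top.ne) _
    obtain ⟨_, ⟨γ, -, s, rfl⟩, hg⟩ := hf.exists_dist_lt w (lt_min (hm 1) (hm t))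
    have hcase : ∀ x : G, x • V ⊆ W → dist w (γ • translate h s f) < m x →
        ∃ a ∈ A, x⁻¹ * (s * a) ∈ V := by
      intro x hx hd
      by_contra! hno
      refine hd.not_ge ?_
      rw [dist_eq_norm]
      refine Lp.norm_le_norm_of_ae_le ?_
      filter_upwards [indicatorConstLp_coeFn (p := p) (hs := (hVx x).measurableSet)
        (hμs := (hVx x).measure_lt_top.ne) (c := (1 : ℂ)) (μ := weightedMeasure μ p ω),
        indicatorConstLp_coeFn (p := p) (hs := hW.measurableSet)
        (hμs := hW.measure_lt_top.ne) (c := (1 : ℂ)) (μ := weightedMeasure μ p ω),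
        Lp.coeFn_sub w (γ • translate h s f), Lp.coeFn_smul γ (translate h s f),
        coeFn_translate h s f, (quasiMeasurePreserving_translate h s).ae hfA]
        with y h1 h2 h3 h4 h5 h6
      rw [h1, h3, Pi.sub_apply, h4, h2]
      by_cases hy : y ∈ x • V
      · rw [indicator_of_mem hy, indicator_of_mem (hx hy), Pi.smul_apply, h5, h6]
        · simp
        · intro hyA
          refine hno _ hyA ?_
          simpa [mem_smul_set_iff_inv_smul_mem] using hy
      · simp [indicator_of_notMem hy]
    obtain ⟨a, ha, haV⟩ := hcase 1 (by simp [W]) (hg.trans_le (min_le_left _ _))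
    obtain ⟨b, hb, hbV⟩ := hcase t subset_union_right (hg.trans_le (min_le_right _ _))
    exact ⟨s, a, ha, b, hb, by simpa using haV, hbV⟩
  obtain ⟨K, hKc, rfl⟩ := hA
  have hprod : IsSigmaCompact (⋃ i : ℕ × ℕ, V * (K i.1)⁻¹ * K i.2 * V⁻¹) :=
    isSigmaCompact_iUnion_of_isCompact _ fun i =>
      ((hV.mul (hKc i.1).inv).mul (hKc i.2)).mul hV.inv
  refine isSigmaCompact_univ_iff.1 ?_
  convert hprod
  refine (eq_univ_of_forall fun t => ?_).symm
  obtain ⟨s, a, ha, b, hb, haV, hbV⟩ := key t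
  obtain ⟨i, hi⟩ := mem_iUnion.1 ha
  obtain ⟨j, hj⟩ := mem_iUnion.1 hb
  have := mul_mem_mul (mul_mem_mul (mul_mem_mul haV (inv_mem_inv.2 hi)) hj) (inv_mem_inv.2 hbV)
  exact mem_iUnion.2 ⟨(i, j), by simpa [mul_assoc] using this⟩

theorem separableSpace_of_isGammaSDense (hp : p ≠ ∞) (h : IsAdmissible μ p ω S) {Γ : Set ℂ}
    {f : Space μ p ω} (hf : IsGammaSDense Γ h f) : SeparableSpace (Space μ p ω) := by
  have := sigmaCompactSpace_of_isGammaSDense hp h hf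
  have := h.toIsWeight.isLocallyFiniteMeasure
  have : (weightedMeasure μ p ω).InnerRegularCompactLTTop :=
    innerRegularCompactLTTop_withDensity h.toIsWeight.aemeasurable_density
      h.toIsWeight.density_ne_zero
  have : (weightedMeasure μ p ω).Regular := regular_of_innerRegularCompactLTTop _
  -- The operator norms need not be bounded over `S`; on each piece where they are, one
  -- approximation of `f` in `C_c` serves all translates at once.
  have hbdd : ∀ m : ℕ, IsSeparable {g | ∃ s : S, ‖translateCLM hp h s‖ ≤ m ∧
      g = translate h s f} := by
    intro m
    let δ : ℕ → ℝ := fun n => 1 / ((n : ℝ) + 1)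
    have hδ : ∀ n, 0 < δ n := fun n => by positivity
    choose φ hφc hφ hφcont hφp using fun n : ℕ =>
      (Lp.memLp f).exists_hasCompactSupport_eLpNorm_sub_le hp
        (ENNReal.ofReal_pos.2 (hδ n)).ne'
    have hsep : ∀ n, IsSeparable (range fun s : G =>
        (memLp_translate_of_hasCompactSupport (weightedMeasure μ p ω) p
          (hφcont n) (hφc n) s).toLp) := by
      intro n
      have hcont := continuous_toLp_translate (weightedMeasure μ p ω) (p := p) (hφcont n) (hφc n)
      rw [← image_univ, ← iUnion_compactCovering, image_iUnion]
      exact IsSeparable.iUnion fun k => ((isCompact_compactCovering G k).image hcont).isSeparable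
    refine (isSeparable_closure.2 (IsSeparable.iUnion hsep)).mono ?_
    rintro _ ⟨s, hs, rfl⟩
    refine Metric.mem_closure_iff.2 fun ε hε => ?_
    obtain ⟨n, hn⟩ := exists_nat_one_div_lt (show 0 < ε / (m + 1) by positivity)
    refine ⟨_, mem_iUnion.2 ⟨n, s, rfl⟩, ?_⟩
    have hT : (memLp_translate_of_hasCompactSupport (weightedMeasure μ p ω) p
        (hφcont n) (hφc n) s).toLp = translateCLM hp h s (hφp n).toLp := by
      refine Lp.ext ((MemLp.coeFn_toLp _).trans ?_)
      exact (coeFn_translate_of_ae_eq h s (MemLp.coeFn_toLp _)).symm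
    have hd : ‖f - (hφp n).toLp‖ ≤ δ n := by
      rw [← Lp.toLp_coeFn f (Lp.memLp f), ← MemLp.toLp_sub, Lp.norm_toLp]
      exact ENNReal.toReal_le_of_le_ofReal (hδ n).le (hφ n)
    beta_reduce
    rw [hT, ← translateCLM_apply hp, dist_eq_norm, ← map_sub]
    calc _ ≤ ‖translateCLM hp h s‖ * ‖f - (hφp n).toLp‖ := ContinuousLinearMap.le_opNorm _ _
      _ ≤ m * δ n := by gcongr
      _ ≤ (m + 1) * δ n := by gcongr; linarith
      _ < (m + 1) * (ε / (m + 1)) := by gcongr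
      _ = ε := by field_simp
  have horbit : IsSeparable {g | ∃ s : S, g = translate h s f} := by
    refine (IsSeparable.iUnion hbdd).mono ?_
    rintro g ⟨s, hs⟩
    obtain ⟨m, hm⟩ := exists_nat_ge ‖translateCLM hp h s‖
    exact mem_iUnion.2 ⟨m, s, hm, hs⟩
  have hall : IsSeparable {g | ∃ γ ∈ Γ, ∃ s : S, g = γ • translate h s f} := by
    refine (((IsSeparable.of_separableSpace Γ).prod horbit).image
      (f := fun z : ℂ × Space μ p ω => z.1 • z.2) (by fun_prop)).mono ?_
    rintro _ ⟨γ, hγ, s, rfl⟩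
    exact ⟨(γ, translate h s f), ⟨hγ, s, rfl⟩, rfl⟩
  rw [← isSeparable_univ_iff, ← hf.closure_eq]
  exact hall.closure

end Separable

/-! ### Building an `S`-dense vector as a series. -/

section Construction

open Set Filter Topology TopologicalSpace

variable {G : Type*} [Group G] [TopologicalSpace G] [IsTopologicalGroup G]
  [MeasurableSpace G] [BorelSpace G] {μ : Measure G} [μ.IsHaarMeasure]
  {p : ℝ≥0∞} [Fact (1 ≤ p)] {ω : G → ℝ} {S : Set G}

/-- If `f` is `(Γ, S)`-dense, then every `g` is nearly the translate by some `s ∈ S` of a vector `u`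
which is dominated by a small multiple of `f` and supported where `f` is bounded, while `T_s` almost
annihilates everything that is dominated by `f` and supported where `‖f‖ ≤ β`. -/
theorem exists_translate_sub_le (hp : p ≠ ∞) (h : IsAdmissible μ p ω S)
    [Nontrivial (Space μ p ω)] {Γ : Set ℂ} (hΓb : Bornology.IsBounded (Γ \ {0}))
    (hΓ0 : ∃ c : ℝ, 0 < c ∧ ∀ z ∈ Γ \ {0}, c ≤ ‖z‖) {f : Space μ p ω}
    (hf : IsGammaSDense Γ h f) (g : Space μ p ω) {δ ε : ℝ} (hδ : 0 < δ) (hε : 0 < ε) (β : ℝ) :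
    ∃ (s : S) (u : Space μ p ω) (b : ℝ),
      (∀ᵐ t ∂weightedMeasure μ p ω, ‖u t‖ ≤ δ * ‖f t‖) ∧
      (∀ᵐ t ∂weightedMeasure μ p ω, b < ‖f t‖ → u t = 0) ∧
      ‖translate h s u - g‖ ≤ ε ∧
      ∀ v : Space μ p ω, (∀ᵐ t ∂weightedMeasure μ p ω, ‖v t‖ ≤ ‖f t‖) →
        (∀ᵐ t ∂weightedMeasure μ p ω, β < ‖f t‖ → v t = 0) → ‖translate h s v‖ ≤ ε := by
  have hp0 : p ≠ 0 := (zero_lt_one.trans_le Fact.out).ne'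
  obtain ⟨C, hC, hΓC⟩ := hΓb.exists_pos_norm_le
  obtain ⟨c, hc, hΓc⟩ := hΓ0
  obtain ⟨g', hgg', hg'⟩ := (Lp.memLp g).exists_simpleFunc_eLpNorm_sub_lt hp
    (ENNReal.ofReal_pos.2 (half_pos hε)).ne'
  obtain ⟨R, hR⟩ := g'.exists_forall_norm_le
  have hR0 : 0 ≤ R := (norm_nonneg _).trans (hR 1)
  let F : Set G := Function.support g'
  have hF : MeasurableSet F := g'.measurableSet_support
  have hFfin : weightedMeasure μ p ω F ≠ ∞ :=
    (g'.measure_support_lt_top_of_memLp hg' hp0 hp).ne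
  -- Plateau height: `N / 2` dominates `R` (missing the plateau costs at least `|g'|`), `C * |β|`
  -- (values `|f| ≤ β` miss it) and `C * R / δ` (where it is hit, `|g'| ≤ δ |f|`).
  let N : ℝ := 2 * R + 2 * (C * |β|) + 2 * (C * R / δ) + 1
  have hCβ : 0 ≤ C * |β| := by positivity
  have hCR : 0 ≤ C * R / δ := by positivity
  have hNpos : 0 < N := by positivity
  have hNR : R ≤ N / 2 := by simp only [N]; linarith
  have hNβ : C * |β| ≤ N / 2 := by simp only [N]; linarith
  have hNδ : R ≤ δ * (N / 2 / C) := by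
    have : C * R / δ ≤ N / 2 := by simp only [N]; linarith
    rw [← mul_div_assoc, le_div_iff₀ hC, mul_comm R, ← div_le_iff₀' hδ]
    exact this
  let w : Space μ p ω := indicatorConstLp p hF hFfin (N : ℂ)
  -- In a nontrivial space the orbit stays dense after removing `0`, which forces `γ ≠ 0`.
  obtain ⟨x, ⟨⟨γ, hγΓ, s, rfl⟩, hx0⟩, hx⟩ :=
    (hf.sdiff_singleton (0 : Space μ p ω)).exists_dist_lt w
      (lt_min (half_pos hε) (mul_pos hc hε))
  have hγ : γ ∈ Γ \ {0} := ⟨hγΓ, fun h0 => hx0 (by simp [show γ = 0 from h0])⟩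
  have hγc : c ≤ ‖γ‖ := hΓc γ hγ
  have hγC : ‖γ‖ ≤ C := hΓC γ hγ
  rw [dist_comm, dist_eq_norm] at hx
  have hw : ∀ᵐ t ∂weightedMeasure μ p ω, (γ • translate h s f - w : Space μ p ω) t =
      γ * f ((s : G)⁻¹ * t) - F.indicator (fun _ => (N : ℂ)) t := by
    filter_upwards [Lp.coeFn_sub (γ • translate h s f) w, Lp.coeFn_smul γ (translate h s f),
      coeFn_translate h s f, indicatorConstLp_coeFn (p := p) (hs := hF) (hμs := hFfin)
        (c := (N : ℂ))] with t h1 h2 h3 h4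
    rw [h1, Pi.sub_apply, h2, Pi.smul_apply, h3, h4, smul_eq_mul]
  -- The points that `s` carries to where the plateau is hit; there `|f|` is between `N / (2C)` and
  -- `3N / (2c)`.
  let B : Set G := {t | (s : G) * t ∈ F ∧ ‖γ * f t - N‖ < N / 2}
  have hB : MeasurableSet B := (measurable_const_mul (s : G) hF).inter (measurableSet_lt
    (((Lp.stronglyMeasurable f).measurable.const_mul γ).sub_const _).norm measurable_const)
  have hBf : ∀ t ∈ B, N / 2 ≤ ‖γ‖ * ‖f t‖ ∧ ‖γ‖ * ‖f t‖ ≤ 3 * N / 2 := by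
    rintro t ⟨-, ht⟩
    have hN : ‖(N : ℂ)‖ = N := by simp [abs_of_pos hNpos]
    have h1 := norm_sub_norm_le (N : ℂ) (γ * f t)
    have h2 := norm_sub_norm_le (γ * f t) (N : ℂ)
    rw [norm_sub_rev] at h1
    rw [hN, norm_mul] at h1 h2
    constructor <;> linarith
  let U : G → ℂ := B.indicator fun t => g' ((s : G) * t)
  have hUf : ∀ t, ‖U t‖ ≤ δ * ‖f t‖ := by
    intro t
    by_cases ht : t ∈ B
    · simp only [U, indicator_of_mem ht]
      refine (hR _).trans (hNδ.trans ?_)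
      gcongr
      rw [div_le_iff₀' hC]
      exact (hBf t ht).1.trans (by gcongr)
    · simp only [U, indicator_of_notMem ht, norm_zero]
      positivity
  have hU : MemLp U p (weightedMeasure μ p ω) :=
    (Lp.memLp f).of_le_mul ((g'.measurable.comp
      (measurable_const_mul (s : G))).indicator hB).aestronglyMeasurable (.of_forall hUf)
  refine ⟨s, hU.toLp, 3 * N / 2 / c, ?_, ?_, ?_, fun v hvf hvβ => ?_⟩
  · filter_upwards [hU.coeFn_toLp] with t ht
    rw [ht]
    exact hUf t
  · filter_upwards [hU.coeFn_toLp] with t ht hlt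
    rw [ht]
    refine indicator_of_notMem (fun htB => ?_) _
    rw [div_lt_iff₀' hc] at hlt
    have := (hBf t htB).2
    have : c * ‖f t‖ ≤ ‖γ‖ * ‖f t‖ := by gcongr
    linarith
  · have h1 : ‖translate h s hU.toLp - hg'.toLp‖ ≤ ‖γ • translate h s f - w‖ := by
      refine Lp.norm_le_norm_of_ae_le ?_
      filter_upwards [hw, Lp.coeFn_sub (translate h s hU.toLp) hg'.toLp, hg'.coeFn_toLp,
        coeFn_translate_of_ae_eq h s hU.coeFn_toLp] with t h1 h2 h3 h4
      rw [h1, h2, Pi.sub_apply, h3, h4]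
      by_cases htF : t ∈ F
      · rw [indicator_of_mem htF]
        by_cases htB : (s : G)⁻¹ * t ∈ B
        · simp [U, indicator_of_mem htB]
        · simp only [U, indicator_of_notMem htB, zero_sub, norm_neg]
          refine (hR t).trans (hNR.trans (not_lt.1 fun hlt => htB ⟨by simpa using htF, hlt⟩))
      · have htB : (s : G)⁻¹ * t ∉ B := fun htB => htF (by simpa using htB.1)
        simp [U, indicator_of_notMem htB, Function.notMem_support.1 htF]
    have h2 : ‖hg'.toLp - g‖ ≤ ε / 2 := by
      rw [norm_sub_rev, ← Lp.toLp_coeFn g (Lp.memLp g), ← MemLp.toLp_sub, Lp.norm_toLp]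
      exact ENNReal.toReal_le_of_le_ofReal (half_pos hε).le hgg'.le
    have h3 := norm_sub_le_norm_sub_add_norm_sub (translate h s hU.toLp) hg'.toLp g
    have h4 := hx.trans_le (min_le_left _ _)
    linarith
  · have h1 : ‖translate h s v‖ ≤ c⁻¹ * ‖γ • translate h s f - w‖ := by
      refine Lp.norm_le_mul_norm_of_ae_le_mul ?_
      filter_upwards [hw, coeFn_translate h s v, (quasiMeasurePreserving_translate h s).ae hvf,
        (quasiMeasurePreserving_translate h s).ae hvβ] with t h1 h2 h3 h4
      rw [h1, h2, inv_mul_eq_div, le_div_iff₀' hc]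
      rcases lt_or_ge β ‖f ((s : G)⁻¹ * t)‖ with hlt | hle
      · rw [h4 hlt, norm_zero, mul_zero]
        exact norm_nonneg _
      · have h5 : c * ‖v ((s : G)⁻¹ * t)‖ ≤ ‖γ * f ((s : G)⁻¹ * t)‖ := by
          rw [norm_mul]
          gcongr
        refine h5.trans ?_
        by_cases htF : t ∈ F
        · rw [indicator_of_mem htF, norm_sub_rev]
          have h6 : ‖γ * f ((s : G)⁻¹ * t)‖ ≤ N / 2 := by
            rw [norm_mul]
            refine le_trans ?_ hNβ
            gcongr
            exact hle.trans (le_abs_self β)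
          have h7 := norm_sub_norm_le (N : ℂ) (γ * f ((s : G)⁻¹ * t))
          have hN : ‖(N : ℂ)‖ = N := by simp [abs_of_pos hNpos]
          linarith
        · rw [indicator_of_notMem htF, sub_zero]
    refine h1.trans ?_
    rw [inv_mul_eq_div, div_le_iff₀' hc]
    exact (hx.trans_le (min_le_right _ _)).le

theorem exists_isSDense_of_isGammaSDense (hp : p ≠ ∞) (h : IsAdmissible μ p ω S)
    [Nontrivial (Space μ p ω)] [SeparableSpace (Space μ p ω)]
    {Γ : Set ℂ} (hΓb : Bornology.IsBounded (Γ \ {0}))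
    (hΓ0 : ∃ c : ℝ, 0 < c ∧ ∀ z ∈ Γ \ {0}, c ≤ ‖z‖) {f : Space μ p ω}
    (hf : IsGammaSDense Γ h f) : ∃ f' : Space μ p ω, IsSDense h f' := by
  -- Unpairing repeats every target infinitely often, so the errors `2 * (1 / 2) ^ n` can be made
  -- small at each of them.
  let x : ℕ → Space μ p ω := fun n => denseSeq (Space μ p ω) n.unpair.1
  let δ : ℕ → ℝ → ℝ := fun n D => (1 / 2) ^ n / ((1 + |D|) * (1 + ‖f‖))
  have hδ : ∀ n D, 0 < δ n D := fun n D => by positivity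
  -- The divisor `n + 1` counts the `n` earlier terms and the `n`-th approximation error.
  have hε : ∀ n : ℕ, (0 : ℝ) < (1 / 2) ^ n / (n + 1) := fun n => by positivity
  choose s' u' b' hdom' hsupp' happrox' hsmall' using fun (n : ℕ) (q : ℝ × ℝ) =>
    exists_translate_sub_le hp h hΓb hΓ0 hf (x n) (hδ n q.2) (hε n) q.1
  -- Running maxima over the earlier stages: the bounds for `|f|` on the supports of the `u_k`, and
  -- the norms of the `T_k`.
  let q : ℕ → ℝ × ℝ := fun n => Nat.rec (0, 0)
    (fun n r => (max r.1 (b' n r), max r.2 ‖translateCLM hp h (s' n r)‖)) n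
  have hq1 : Monotone fun n => (q n).1 := monotone_nat_of_le_succ fun n => le_max_left _ _
  have hq2 : Monotone fun n => (q n).2 := monotone_nat_of_le_succ fun n => le_max_left _ _
  let s : ℕ → S := fun n => s' n (q n)
  let u : ℕ → Space μ p ω := fun n => u' n (q n)
  let T : ℕ → Space μ p ω →L[ℂ] Space μ p ω := fun n => translateCLM hp h (s n)
  have hb : ∀ {k n}, k < n → b' k (q k) ≤ (q n).1 := fun {k n} hkn =>
    (le_max_right _ _ : b' k (q k) ≤ (q (k + 1)).1).trans (hq1 (Nat.succ_le_of_lt hkn))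
  have hTq : ∀ {k n}, k < n → ‖T k‖ ≤ (q n).2 := fun {k n} hkn =>
    (le_max_right _ _ : ‖T k‖ ≤ (q (k + 1)).2).trans (hq2 (Nat.succ_le_of_lt hkn))
  have hu : ∀ n, ‖u n‖ ≤ δ n (q n).2 * ‖f‖ := fun n =>
    Lp.norm_le_mul_norm_of_ae_le_mul (hdom' n (q n))
  have hδf : ∀ n D, (1 + |D|) * (δ n D * ‖f‖) ≤ (1 / 2) ^ n := by
    intro n D
    calc (1 + |D|) * (δ n D * ‖f‖) ≤ (1 + |D|) * (δ n D * (1 + ‖f‖)) := by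
          have := (hδ n D).le
          gcongr
          linarith
      _ = (1 / 2) ^ n := by simp only [δ]; field_simp
  have hδ1 : ∀ n D, δ n D ≤ 1 := by
    intro n D
    refine div_le_one_of_le₀ ((pow_le_one₀ (by norm_num) (by norm_num)).trans ?_) (by positivity)
    exact one_le_mul_of_one_le_of_one_le (by simp) (by simp)
  have husum : Summable u := by
    refine Summable.of_norm_bounded summable_geometric_two fun n => (hu n).trans ?_
    refine le_trans ?_ (hδf n (q n).2)
    exact le_mul_of_one_le_left (mul_nonneg (hδ _ _).le (norm_nonneg _)) (by simp)
  have hlate : ∀ {n k}, n < k → ‖T n (u k)‖ ≤ (1 / 2) ^ k := by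
    intro n k hnk
    calc ‖T n (u k)‖ ≤ ‖T n‖ * ‖u k‖ := (T n).le_opNorm _
      _ ≤ (1 + |(q k).2|) * (δ k (q k).2 * ‖f‖) := by
          gcongr
          · linarith [hTq hnk, le_abs_self (q k).2]
          · exact hu k
      _ ≤ _ := hδf _ _
  have hearly : ∀ {n k}, k < n → ‖T n (u k)‖ ≤ (1 / 2) ^ n / (n + 1) := by
    intro n k hkn
    refine hsmall' n (q n) (u k) ?_ ?_
    · filter_upwards [hdom' k (q k)] with t ht
      exact ht.trans (mul_le_of_le_one_left (norm_nonneg _) (hδ1 _ _))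
    · filter_upwards [hsupp' k (q k)] with t ht hlt
      exact ht ((hb hkn).trans_lt hlt)
  have hmain : ∀ n, ‖T n (∑' k, u k) - x n‖ ≤ 2 * (1 / 2) ^ n := by
    intro n
    have hTsum : Summable fun k => T n (u k) := (T n).summable husum
    have htail : ‖∑' k, T n (u (k + (n + 1)))‖ ≤ (1 / 2) ^ n := by
      refine tsum_of_norm_bounded (g := fun k : ℕ => (1 / 2 : ℝ) ^ (n + 1) * (1 / 2) ^ k) ?_
        fun k => ?_
      · have := hasSum_geometric_two.mul_left ((1 / 2 : ℝ) ^ (n + 1))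
        rwa [pow_succ, mul_assoc, one_div_mul_cancel two_ne_zero, mul_one, ← pow_succ] at this
      · rw [← pow_add, add_comm (n + 1)]
        exact hlate (by omega)
    have hhead : ‖∑ k ∈ Finset.range n, T n (u k)‖ ≤ n * ((1 / 2) ^ n / (n + 1)) := by
      refine (norm_sum_le_of_le _ fun k hk => hearly (Finset.mem_range.1 hk)).trans ?_
      simp
    have hn : ‖T n (u n) - x n‖ ≤ (1 / 2) ^ n / (n + 1) := happrox' n (q n)
    rw [(T n).map_tsum husum, ← hTsum.sum_add_tsum_nat_add (n + 1), Finset.sum_range_succ]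
    calc _ = ‖∑ k ∈ Finset.range n, T n (u k) + (T n (u n) - x n) +
            ∑' k, T n (u (k + (n + 1)))‖ := by congr 1; abel
      _ ≤ n * ((1 / 2) ^ n / (n + 1)) + (1 / 2) ^ n / (n + 1) + (1 / 2) ^ n :=
          norm_add₃_le.trans (by gcongr)
      _ = 2 * (1 / 2) ^ n := by field_simp; ring
  refine ⟨∑' k, u k, Metric.dense_iff.2 fun y ε hε => ?_⟩
  obtain ⟨j, hj⟩ := (denseRange_denseSeq (Space μ p ω)).exists_dist_lt y (half_pos hε)
  obtain ⟨m, hm⟩ := exists_pow_lt_of_lt_one (show 0 < ε / 4 by positivity)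
    (show (1 / 2 : ℝ) < 1 by norm_num)
  have hx : x (Nat.pair j m) = denseSeq (Space μ p ω) j := by simp [x]
  have hd := hmain (Nat.pair j m)
  have hpow : (1 / 2 : ℝ) ^ Nat.pair j m ≤ (1 / 2) ^ m :=
    pow_le_pow_of_le_one (by norm_num) (by norm_num) (Nat.right_le_pair j m)
  rw [hx, ← dist_eq_norm] at hd
  refine ⟨T (Nat.pair j m) (∑' k, u k), ?_, s (Nat.pair j m), rfl⟩
  rw [Metric.mem_ball]
  have := dist_triangle_right (T (Nat.pair j m) (∑' k, u k)) y (denseSeq (Space μ p ω) j)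
  linarith

end Construction

end WeightedLp

theorem mainTheorem5 {G : Type*} [Group G] [TopologicalSpace G] [IsTopologicalGroup G]
    [LocallyCompactSpace G] [T2Space G] [MeasurableSpace G] [BorelSpace G]
    (μ : Measure G) [μ.IsHaarMeasure] [μ.Regular]
    (p : ℝ≥0∞) [Fact (1 ≤ p)] (hp : p ≠ ∞)
    (S : Set G) (ω : G → ℝ) (hω : WeightedLp.IsAdmissible μ p ω S)
    (Γ : Set ℂ) (hΓ : (Γ \ {0}).Nonempty) (hΓb : Bornology.IsBounded (Γ \ {0}))
    (hΓ0 : ∃ c : ℝ, 0 < c ∧ ∀ z ∈ Γ \ {0}, c ≤ ‖z‖) :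
    (∃ f : WeightedLp.Space μ p ω, WeightedLp.IsSDense hω f) ↔
      (∃ f : WeightedLp.Space μ p ω, WeightedLp.IsGammaSDense Γ hω f) := by
  constructor
  · rintro ⟨f, hf⟩
    obtain ⟨γ, hγ, hγ0⟩ := hΓ
    refine ⟨f, ((Homeomorph.smulOfNeZero γ hγ0).surjective.denseRange.dense_image
      (Homeomorph.smulOfNeZero γ hγ0).continuous hf).mono ?_⟩
    rintro _ ⟨_, ⟨s, rfl⟩, rfl⟩
    exact ⟨γ, hγ, s, rfl⟩
  · rintro ⟨f, hf⟩
    -- In the zero space `0` cannot be removed from the orbit; there density only requires `S` to be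
    -- nonempty.
    rcases subsingleton_or_nontrivial (WeightedLp.Space μ p ω) with _ | _
    · obtain ⟨_, -, -, s, -⟩ := hf.nonempty
      exact ⟨f, fun g => subset_closure ⟨s, Subsingleton.elim _ _⟩⟩
    · have := WeightedLp.separableSpace_of_isGammaSDense hp hω hf
      exact WeightedLp.exists_isSDense_of_isGammaSDense hp hω hΓb hΓ0 hf
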